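/- Let $H$ be a hypothesis class, i.e. a set of functions $\mathbb{N}\to\{0,1\}$. A Littlestone tree of depth $d$ is a complete rooted binary tree of depth $d$ whose non-leaf nodes are labeled by natural numbers and in which every non-leaf node has one outgoing edge labeled $0$ and one outgoing edge labeled $1$. A leaf $\ell$ of such a tree is called $H$-realizable if there is $f\in H$ such that $f(x)=y$ for every edge on the path from the root to $\ell$, where $y$ is the label of the edge and $x$ is the label of the node at which the edge starts. The effective Littlestone dimension of $H$ is the minimal $d\ge 0$ for which there exists a total Turing machine that, given as input a Littlestone tree of depth $d+1$, outputs some leaf of this tree which is not $H$-realizable (it is infinite if there is no such $d$). **Theorem.** If $H$ has finite effective Littlestone dimension, then every function in $H$ is computable. -/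

import Mathlib

namespace EffLittlestone

/-- A hypothesis class is a set of functions from `ℕ` to `{0, 1}`. -/
abbrev HypothesisClass : Type := Set (ℕ → Bool)

/-- A sample is a finite sequence of pairs from `ℕ × {0, 1}`. -/
abbrev Sample : Type := List (ℕ × Bool)

/-- A sample is consistent with `f` if `f x = y` for each of its pairs `(x, y)`. -/
def Sample.Consistent (S : Sample) (f : ℕ → Bool) : Prop :=
  ∀ p ∈ S, f p.1 = p.2

/-- A sample is `H`-realizable if it is consistent with some function in `H`. -/
def Sample.Realizable (S : Sample) (H : HypothesisClass) : Prop :=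
  ∃ f ∈ H, S.Consistent f

/-- Littlestone trees of depth `d`: complete rooted binary trees of depth `d` whose non-leaf nodes
are labeled by natural numbers. A tree of depth `0` is a single (unlabeled) leaf; a tree of depth
`d + 1` is a triple `(x, T₀, T₁)` consisting of the label `x` of the root, the subtree `T₀` below
the outgoing `0`-edge and the subtree `T₁` below the outgoing `1`-edge. -/
def LTree : ℕ → Type
  | 0 => Unit
  | d + 1 => ℕ × LTree d × LTree d

/-- The structural coding of Littlestone trees by natural numbers (iterated pairing), through which
they are given to algorithms. -/
instance LTree.instPrimcodable : (d : ℕ) → Primcodable (LTree d)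
  | 0 => inferInstanceAs (Primcodable Unit)
  | d + 1 =>
    letI := LTree.instPrimcodable d
    inferInstanceAs (Primcodable (ℕ × LTree d × LTree d))

/-- A leaf of a tree of depth `d` is given by the bits on the edges of the path from the root to
that leaf. -/
abbrev Leaf (d : ℕ) : Type := List.Vector Bool d

/-- The sample written on the path from the root of `T` to a leaf: each edge contributes the pair
(label of the node at which the edge starts, bit labeling the edge). -/
def LTree.sampleAt : {d : ℕ} → LTree d → Leaf d → Sample
  | 0, _, _ => []
  | _ + 1, (x, T₀, T₁), l => (x, l.head) :: LTree.sampleAt (bif l.head then T₁ else T₀) l.tail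

/-- There is a total algorithm that, given a Littlestone tree of depth `d + 1`, outputs a leaf of
this tree which is not `H`-realizable. -/
def HasUnrealizableLeafAlgorithm (H : HypothesisClass) (d : ℕ) : Prop :=
  ∃ A : LTree (d + 1) → Leaf (d + 1),
    Computable A ∧ ∀ T : LTree (d + 1), ¬ (T.sampleAt (A T)).Realizable H

/-- The effective Littlestone dimension of `H`: the minimal `d ≥ 0` for which there is a total
algorithm that, given a Littlestone tree of depth `d + 1`, outputs a leaf of this tree which is not
`H`-realizable; it is `⊤` (infinite) if there is no such `d`. -/
noncomputable def eldim (H : HypothesisClass) : ℕ∞ :=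
  sInf {n : ℕ∞ | ∃ d : ℕ, n = d ∧ HasUnrealizableLeafAlgorithm H d}

end EffLittlestone

/-!
Let `A` be an algorithm finding unrealizable leaves in trees of depth `d + 1`. The class `C` of all
functions that are inconsistent with the sample leading to `A T`, for every tree `T`, contains `H`,
is effectively closed in Cantor space, and still shatters no tree of depth `d + 1`. So it suffices
that every member `f` of an effectively closed class `C` shattering no tree of some depth `d` is
computable (`EffectivelyClosed.computable_of_not_shatters`). This is proved by induction on `d`.

Suppose that `f` is not computable.

* If `g ∈ C` and `g ≠ f`, choose `x` with `g x ≠ f x`. One of the two classes obtained from `C` by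
  prescribing the value at `x` shatters no tree of depth `d - 1`
  (`exists_restrict_not_shatters`), so by induction its members are computable; it contains `f` or
  `g`, hence it contains `g`. Thus all members of `C` other than `f` are computable.
* `f` is a limit of other members of `C`: otherwise it is the only member of an effectively closed
  class, and compactness makes it computable (`EffectivelyClosed.computable_of_unique`).
* `f` is not a Boolean combination of finitely many other members of `C`, as these are computable
  (`computable_of_determined`).

The last two facts contradict stability (`exists_shatters_of_not_determined`). They yield functions
`g n ∈ C` and points `x n`, `y n`, with `f (x n) = 1` and `f (y n) = 0`, such that `g i` takes equal
values at `x n` and `y n` for `i < n`, and agrees with `f` at both for `i > n`. By Ramsey's theorem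
(`exists_monochromatic_list`) the former values may be assumed constant along a long list of
indices, which then carries a half-graph, and a long half-graph contains a shattered tree
(`exists_shatters_of_halfGraph`).
-/

namespace EffLittlestone

/-! ### Effectively closed classes -/

/-- A hypothesis class is effectively closed if it consists of the functions that avoid (are
inconsistent with) every sample of some effectively enumerated family. The enumeration is by finite
batches and primitive recursive; a batch may be empty, so this is no loss compared with an
arbitrary computable enumeration, whose steps can be simulated with growing time bounds. -/
def EffectivelyClosed (C : HypothesisClass) : Prop :=
  ∃ s : ℕ → List Sample, Primrec s ∧ ∀ g, g ∈ C ↔ ∀ n, ∀ S ∈ s n, ¬ S.Consistent g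

theorem EffectivelyClosed.restrict {C : HypothesisClass} (hC : EffectivelyClosed C) (x : ℕ)
    (b : Bool) : EffectivelyClosed {g ∈ C | g x = b} := by
  obtain ⟨s, hs, hsC⟩ := hC
  refine ⟨fun n => Nat.casesOn n [[(x, !b)]] s, ?_, fun g => ?_⟩
  · exact Primrec.nat_casesOn Primrec.id (Primrec.const _) (hs.comp Primrec.snd).to₂
  · constructor
    · rintro ⟨hg, hx⟩ (_ | n) S hS
      · obtain rfl : S = [(x, !b)] := by simpa using hS
        intro h
        have := h _ List.mem_cons_self
        simp [hx] at this
      · exact (hsC g).1 hg n S hS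
    · intro h
      refine ⟨(hsC g).2 fun n => h (n + 1), ?_⟩
      have := h 0 [(x, !b)] (by simp)
      simpa [Sample.Consistent] using this

theorem EffectivelyClosed.restrict_finset {C : HypothesisClass} (hC : EffectivelyClosed C)
    (f : ℕ → Bool) (F : Finset ℕ) : EffectivelyClosed {g ∈ C | ∀ x ∈ F, g x = f x} := by
  classical
  induction F using Finset.induction_on with
  | empty => simpa using hC
  | insert a F _ ih =>
    convert ih.restrict a (f a) using 1
    ext g
    simp only [Finset.forall_mem_insert, Set.mem_ofPred_eq]
    tauto

theorem isOpen_setOf_apply_eq (x : ℕ) (b : Bool) : IsOpen {g : ℕ → Bool | g x = b} := by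
  have h : {g : ℕ → Bool | g x = b} = (fun g => g x) ⁻¹' {b} := by ext g; simp
  rw [h]
  exact (isOpen_discrete {b}).preimage (continuous_apply x)

theorem Sample.isOpen_setOf_consistent (S : Sample) : IsOpen {g : ℕ → Bool | S.Consistent g} := by
  have h : {g : ℕ → Bool | S.Consistent g} = ⋂ p ∈ {p | p ∈ S}, {g | g p.1 = p.2} := by
    ext g; simp [Sample.Consistent]
  rw [h]
  exact (List.finite_toSet S).isOpen_biInter fun p _ =>
    isOpen_setOf_apply_eq p.1 p.2

/-! ### Isolated functions are computable -/

/-- `RefutedBy s N x b` says that stage `N` reveals that no function avoiding all samples of `s`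
has value `!b` at `x`: each binary string of length `N` (given by the bits of some `m < 2 ^ N`)
whose entry at `x` is not `b` is consistent with a sample, with all its points below `N`, from one
of the first `N` batches. -/
def RefutedBy (s : ℕ → List Sample) (N x : ℕ) (b : Bool) : Prop :=
  x < N ∧ ∀ m < 2 ^ N, m.testBit x = b ∨
    ∃ n < N, ∃ S ∈ s n, ∀ p ∈ S, p.1 < N ∧ m.testBit p.1 = p.2

theorem primrec_testBit : Primrec₂ Nat.testBit := by
  have hpow : Primrec₂ ((· ^ ·) : ℕ → ℕ → ℕ) := Primrec₂.unpaired'.1 Nat.Primrec.pow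
  have h : PrimrecRel fun m i : ℕ => m / 2 ^ i % 2 = 1 :=
    Primrec.eq.comp (Primrec.nat_mod.comp (Primrec.nat_div.comp Primrec.fst
      (hpow.comp (Primrec.const 2) Primrec.snd)) (Primrec.const 2)) (Primrec.const 1)
  exact h.decide.of_eq fun m i => by rw [Nat.testBit_eq_decide_div_mod_eq]

theorem primrecPred_refutedBy {s : ℕ → List Sample} (hs : Primrec s) :
    PrimrecPred fun a : ℕ × ℕ × Bool => RefutedBy s a.1 a.2.1 a.2.2 := by
  have hpow : Primrec₂ ((· ^ ·) : ℕ → ℕ → ℕ) := Primrec₂.unpaired'.1 Nat.Primrec.pow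
  have h1 : PrimrecRel fun (p : ℕ × Bool) (c : ℕ × ℕ) => p.1 < c.1 ∧ c.2.testBit p.1 = p.2 :=
    (Primrec.nat_lt.comp (Primrec.fst.comp Primrec.fst) (Primrec.fst.comp Primrec.snd)).and
      (Primrec.eq.comp (primrec_testBit.comp (Primrec.snd.comp Primrec.snd)
        (Primrec.fst.comp Primrec.fst)) (Primrec.snd.comp Primrec.fst))
  have h2 : PrimrecRel fun (n : ℕ) (c : ℕ × ℕ) =>
      ∃ S ∈ s n, ∀ p ∈ S, p.1 < c.1 ∧ c.2.testBit p.1 = p.2 :=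
    h1.forall_mem_list.exists_mem_list.comp (hs.comp Primrec.fst) Primrec.snd
  have h2' : PrimrecPred fun q : ℕ × ℕ × ℕ × Bool =>
      ∃ n < q.2.1, ∃ S ∈ s n, ∀ p ∈ S, p.1 < q.2.1 ∧ q.1.testBit p.1 = p.2 :=
    (h2.exists_mem_list.comp (Primrec.list_range.comp (Primrec.fst.comp Primrec.snd))
      (Primrec.pair (Primrec.fst.comp Primrec.snd) Primrec.fst)).of_eq fun q => by simp
  have h3 : PrimrecRel fun (m : ℕ) (a : ℕ × ℕ × Bool) => m.testBit a.2.1 = a.2.2 ∨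
      ∃ n < a.1, ∃ S ∈ s n, ∀ p ∈ S, p.1 < a.1 ∧ m.testBit p.1 = p.2 :=
    (Primrec.eq.comp (primrec_testBit.comp Primrec.fst
      (Primrec.fst.comp (Primrec.snd.comp Primrec.snd)))
      (Primrec.snd.comp (Primrec.snd.comp Primrec.snd))).or h2'
  exact (Primrec.nat_lt.comp (Primrec.fst.comp Primrec.snd) Primrec.fst).and
    ((h3.forall_mem_list.comp (Primrec.list_range.comp (hpow.comp (Primrec.const 2) Primrec.fst))
      Primrec.id).of_eq fun a => by simp)

theorem RefutedBy.eq {s : ℕ → List Sample} {N x : ℕ} {b : Bool} (h : RefutedBy s N x b)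
    {g : ℕ → Bool} (hg : ∀ n, ∀ S ∈ s n, ¬ S.Consistent g) : g x = b := by
  -- `m` codes the restriction of `g` to `{0, …, N - 1}`
  set m := Nat.ofBits fun i : Fin N => g i with hm
  have hbit : ∀ i < N, m.testBit i = g i := fun i hi => by
    rw [hm, Nat.testBit_ofBits_lt _ _ hi]
  rcases h.2 m (Nat.ofBits_lt_two_pow _) with h' | ⟨n, -, S, hS, hp⟩
  · rw [← hbit x h.1, h']
  · exact absurd (fun p hpS => by rw [← hbit _ (hp p hpS).1, (hp p hpS).2]) (hg n S hS)

/-- If every function avoiding all samples of `s` has value `b` at `x`, then some finite stage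
reveals this: a compactness argument in Cantor space. -/
theorem exists_refutedBy {s : ℕ → List Sample} {x : ℕ} {b : Bool}
    (h : ∀ g : ℕ → Bool, (∀ n, ∀ S ∈ s n, ¬ S.Consistent g) → g x = b) :
    ∃ N, RefutedBy s N x b := by
  have hopen : ∀ n, IsOpen {g : ℕ → Bool | g x = b ∨ ∃ S ∈ s n, S.Consistent g} := fun n => by
    have : {g : ℕ → Bool | g x = b ∨ ∃ S ∈ s n, S.Consistent g} =
        {g | g x = b} ∪ ⋃ S ∈ {S | S ∈ s n}, {g | Sample.Consistent S g} := by
      ext g; simp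
    rw [this]
    exact (isOpen_setOf_apply_eq x b).union
      (isOpen_biUnion fun S _ => Sample.isOpen_setOf_consistent S)
  obtain ⟨t, ht⟩ := isCompact_univ.elim_finite_subcover _ hopen fun g _ => by
    by_cases hg : g x = b
    · exact Set.mem_iUnion.2 ⟨0, Or.inl hg⟩
    · have : ¬ ∀ n, ∀ S ∈ s n, ¬ S.Consistent g := fun h' => hg (h g h')
      push Not at this
      obtain ⟨n, S, hS, hc⟩ := this
      exact Set.mem_iUnion.2 ⟨n, Or.inr ⟨S, hS, hc⟩⟩
  have hN : ∀ᶠ N in Filter.atTop, x < N ∧ ∀ n ∈ t, n < N ∧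
      ∀ S ∈ {S | S ∈ s n}, ∀ p ∈ {p | p ∈ S}, p.1 < N := by
    refine (Filter.eventually_gt_atTop x).and ((Filter.eventually_all_finset t).2 fun n _ =>
      (Filter.eventually_gt_atTop n).and ?_)
    refine (Filter.eventually_all_finite (List.finite_toSet (s n))).2 fun S _ => ?_
    exact (Filter.eventually_all_finite (List.finite_toSet S)).2 fun p _ =>
      Filter.eventually_gt_atTop p.1
  obtain ⟨N, hxN, hN⟩ := hN.exists
  refine ⟨N, hxN, fun m _ => ?_⟩
  obtain ⟨n, hn, hm⟩ : ∃ n ∈ t, m.testBit x = b ∨ ∃ S ∈ s n, S.Consistent m.testBit := by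
    simpa using ht (Set.mem_univ m.testBit)
  refine hm.imp_right fun ⟨S, hS, hc⟩ => ⟨n, (hN n hn).1, S, hS, fun p hp => ⟨?_, hc p hp⟩⟩
  exact (hN n hn).2 S hS p hp

/-- The only member of an effectively closed class is computable: search for a stage revealing
its value. -/
theorem EffectivelyClosed.computable_of_unique {C : HypothesisClass} (hC : EffectivelyClosed C)
    {f : ℕ → Bool} (hf : f ∈ C) (huniq : ∀ g ∈ C, g = f) : Computable f := by
  classical
  obtain ⟨s, hs, hsC⟩ := hC
  let c : ℕ → ℕ → Option Bool := fun x N =>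
    if RefutedBy s N x true then some true else if RefutedBy s N x false then some false else none
  have hP : ∀ b : Bool, PrimrecPred fun a : ℕ × ℕ => RefutedBy s a.2 a.1 b := fun b =>
    (primrecPred_refutedBy hs).comp
      (Primrec.pair Primrec.snd (Primrec.pair Primrec.fst (Primrec.const b)))
  have hc : Primrec₂ c := Primrec.ite (hP true) (Primrec.const _)
    (Primrec.ite (hP false) (Primrec.const _) (Primrec.const _))
  have hval : ∀ {x N b}, b ∈ c x N → b = f x := fun {x N b} hb => by
    have hb' : RefutedBy s N x b := by
      simp only [c] at hb
      split_ifs at hb <;> simp_all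
    exact (hb'.eq ((hsC f).1 hf)).symm
  have hdom : ∀ x, (Nat.rfindOpt (c x)).Dom := fun x => Nat.rfindOpt_dom.2 <| by
    obtain ⟨N, hN⟩ := exists_refutedBy (s := s) (x := x) (b := f x)
      fun g hg => by rw [huniq g ((hsC g).2 hg)]
    refine ⟨N, ?_⟩
    simp only [c]
    split_ifs with h1 h2
    · exact ⟨_, rfl⟩
    · exact ⟨_, rfl⟩
    · cases hfx : f x <;> simp_all
  refine (Partrec.rfindOpt hc.to_comp).of_eq fun x => ?_
  obtain ⟨b, hb⟩ := Part.dom_iff_mem.1 (hdom x)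
  obtain ⟨N, hN⟩ := Nat.rfindOpt_spec hb
  rw [Part.eq_some_iff.2 hb, hval hN]
  rfl

/-! ### Functions determined by finitely many computable functions -/

/-- A function whose value at `x` depends only on the values at `x` of finitely many computable
functions is computable. -/
theorem computable_of_determined {ι : Type*} (t : Finset ι) (g : ι → ℕ → Bool)
    (hg : ∀ i ∈ t, Computable (g i)) {f : ℕ → Bool}
    (hf : ∀ x y, (∀ i ∈ t, g i x = g i y) → f x = f y) : Computable f := by
  classical
  let e := t.equivFin.symm
  let v : ℕ → List.Vector Bool t.card := fun x => List.Vector.ofFn fun j => g (e j) x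
  have hv : Computable v := Computable.vector_ofFn fun j => hg _ (e j).2
  have hfac : ∀ x y, v x = v y → f x = f y := fun x y hxy => hf x y fun i hi => by
    have := congrArg (fun w => w.get (e.symm ⟨i, hi⟩)) hxy
    simpa [v] using this
  let φ : List.Vector Bool t.card → Bool := fun w =>
    if h : ∃ x, v x = w then f h.choose else false
  refine ((Primrec.dom_finite φ).to_comp.comp hv).of_eq fun x => ?_
  have h : ∃ y, v y = v x := ⟨x, rfl⟩
  simp only [φ, dif_pos h]
  exact hfac _ _ h.choose_spec

/-! ### The class of functions avoiding computed samples -/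

theorem primrec₂_sampleAt : ∀ d : ℕ, Primrec₂ (LTree.sampleAt : LTree d → Leaf d → Sample)
  | 0 => (Primrec.const ([] : Sample)).of_eq fun _ => rfl
  | d + 1 => by
    have ih := primrec₂_sampleAt d
    have h : Primrec fun a : (ℕ × LTree d × LTree d) × Leaf (d + 1) =>
        (a.1.1, a.2.head) ::
          LTree.sampleAt (bif a.2.head then a.1.2.2 else a.1.2.1) a.2.tail := by
      have hx := Primrec.fst (α := ℕ × LTree d × LTree d) (β := Leaf (d + 1))
      have hl := Primrec.snd (α := ℕ × LTree d × LTree d) (β := Leaf (d + 1))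
      have hh := Primrec.vector_head.comp hl
      exact Primrec.list_cons.comp (Primrec.pair (Primrec.fst.comp hx) hh)
        (ih.comp (Primrec.cond hh (Primrec.snd.comp (Primrec.snd.comp hx))
          (Primrec.fst.comp (Primrec.snd.comp hx))) (Primrec.vector_tail.comp hl))
    exact h

/-- The functions avoiding a computable family of samples form an effectively closed class. -/
theorem effectivelyClosed_of_computable {α : Type*} [Primcodable α] {F : α → Sample}
    (hF : Computable F) : EffectivelyClosed {g | ∀ a, ¬ (F a).Consistent g} := by
  obtain ⟨c, hc⟩ := Nat.Partrec.Code.exists_code.1 hF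
  -- stage `Nat.pair k n` runs the algorithm for `k` steps on the input coded by `n`
  let s : ℕ → List Sample := fun m =>
    (((Nat.Partrec.Code.evaln m.unpair.1 c m.unpair.2).bind
      fun r => (Encodable.decode r : Option Sample)).map fun S => [S]).getD []
  have hs : Primrec s := by
    have h1 : Primrec fun m : ℕ => Nat.Partrec.Code.evaln m.unpair.1 c m.unpair.2 :=
      Nat.Partrec.Code.primrec_evaln.comp (Primrec.pair
        (Primrec.pair (Primrec.fst.comp Primrec.unpair) (Primrec.const c))
        (Primrec.snd.comp Primrec.unpair))
    have h2 : Primrec₂ fun (_ : ℕ) (r : ℕ) => (Encodable.decode r : Option Sample) :=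
      (Primrec.decode.comp Primrec.snd).to₂
    have h3 : Primrec₂ fun (_ : ℕ) (S : Sample) => [S] :=
      (Primrec.list_cons.comp Primrec.snd (Primrec.const [])).to₂
    exact Primrec.option_getD.comp (Primrec.option_map (Primrec.option_bind h1 h2) h3)
      (Primrec.const [])
  have hmem : ∀ S, (∃ m, S ∈ s m) ↔ ∃ a, F a = S := by
    intro S
    have key : ∀ n r, r ∈ c.eval n ↔ ∃ a : α, Encodable.decode n = some a ∧
        Encodable.encode (F a) = r := by
      intro n r
      rw [hc]
      simp [eq_comm]
    constructor
    · rintro ⟨m, hm⟩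
      simp only [s] at hm
      rcases hr : Nat.Partrec.Code.evaln m.unpair.1 c m.unpair.2 with _ | r
      · simp [hr] at hm
      · obtain ⟨a, -, ha⟩ := (key _ _).1 (Nat.Partrec.Code.evaln_sound hr)
        refine ⟨a, ?_⟩
        simp [hr, ← ha] at hm
        exact hm.symm
    · rintro ⟨a, rfl⟩
      obtain ⟨k, hk⟩ := Nat.Partrec.Code.evaln_complete.1
        ((key (Encodable.encode a) _).2 ⟨a, Encodable.encodek a, rfl⟩)
      refine ⟨Nat.pair k (Encodable.encode a), ?_⟩
      simp only [s, Nat.unpair_pair]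
      rw [hk]
      simp
  refine ⟨s, hs, fun g => ⟨fun h n S hS hc => ?_, fun h a ha => ?_⟩⟩
  · obtain ⟨a, rfl⟩ := (hmem S).1 ⟨n, hS⟩
    exact h a hc
  · obtain ⟨m, hm⟩ := (hmem (F a)).2 ⟨a, rfl⟩
    exact h m _ hm ha

/-! ### Shattered trees -/

/-- `Shatters C T` says that every leaf of the Littlestone tree `T` is `C`-realizable. -/
def Shatters {d : ℕ} (C : HypothesisClass) (T : LTree d) : Prop :=
  ∀ l : Leaf d, (T.sampleAt l).Realizable C

theorem shatters_zero {C : HypothesisClass} (hC : C.Nonempty) (T : LTree 0) : Shatters C T :=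
  fun _ => let ⟨g, hg⟩ := hC; ⟨g, hg, by simp [Sample.Consistent, LTree.sampleAt]⟩

theorem shatters_succ {d : ℕ} {C : HypothesisClass} {x : ℕ} {T : Bool → LTree d}
    (hT : ∀ b, Shatters {g ∈ C | g x = b} (T b)) :
    Shatters (d := d + 1) C (x, T false, T true) := by
  intro l
  obtain ⟨g, hg, hc⟩ := hT l.head l.tail
  refine ⟨g, hg.1, ?_⟩
  have hb : (bif l.head then T true else T false) = T l.head := by cases l.head <;> rfl
  simp only [LTree.sampleAt, hb]
  exact List.forall_mem_cons.2 ⟨hg.2, hc⟩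

theorem Shatters.mono {d : ℕ} {C D : HypothesisClass} {T : LTree d} (h : Shatters C T)
    (hCD : C ⊆ D) : Shatters D T :=
  fun l => let ⟨g, hg, hc⟩ := h l; ⟨g, hCD hg, hc⟩

/-- Splitting a class at a point lowers its Littlestone dimension on one of the two sides. -/
theorem exists_restrict_not_shatters {d : ℕ} {C : HypothesisClass}
    (hC : ∀ T : LTree (d + 1), ¬ Shatters C T) (x : ℕ) :
    ∃ b, ∀ T : LTree d, ¬ Shatters {g ∈ C | g x = b} T := by
  by_contra! h
  choose T hT using h
  exact hC _ (shatters_succ hT)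

/-- A half-graph of length `2 ^ (d + 1) - 1` contains a shattered Littlestone tree of depth `d`, by
binary search. -/
theorem exists_shatters_of_halfGraph {ι : Type*} (g : ι → ℕ → Bool) (z : ι → ℕ) (c : Bool) :
    ∀ (d : ℕ) (L : List ι), L.length = 2 ^ (d + 1) - 1 →
      L.Pairwise (fun i j => g i (z j) = c ∧ g j (z i) = !c) →
      ∃ T : LTree d, Shatters {h | ∃ i ∈ L, h = g i} T
  | 0, L, hL, _ => by
    obtain ⟨i, rfl⟩ := List.length_eq_one_iff.1 (by simpa using hL)
    have hne : {h : ℕ → Bool | ∃ j ∈ [i], h = g j}.Nonempty := ⟨g i, i, by simp, rfl⟩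
    exact ⟨(() : Unit), shatters_zero hne _⟩
  | d + 1, L, hL, hP => by
    have hpow : 2 ^ (d + 1 + 1) = 2 * 2 ^ (d + 1) := by ring
    have hpos : 0 < 2 ^ (d + 1) := by positivity
    -- the middle element labels the root: it separates the earlier from the later functions
    obtain ⟨L₁, i, L₂, rfl, h₁⟩ : ∃ L₁ i L₂, L = L₁ ++ i :: L₂ ∧ L₁.length = 2 ^ (d + 1) - 1 := by
      have hlt : 2 ^ (d + 1) - 1 < L.length := by omega
      refine ⟨L.take (2 ^ (d + 1) - 1), L[2 ^ (d + 1) - 1], L.drop (2 ^ (d + 1) - 1 + 1), ?_, ?_⟩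
      · rw [List.getElem_cons_drop, List.take_append_drop]
      · simp; omega
    have h₂ : L₂.length = 2 ^ (d + 1) - 1 := by
      simp only [List.length_append, List.length_cons] at hL
      omega
    obtain ⟨hP₁, hP₂, hP₁₂⟩ := List.pairwise_append.1 hP
    obtain ⟨hi, hP₂⟩ := List.pairwise_cons.1 hP₂
    obtain ⟨T₁, hT₁⟩ := exists_shatters_of_halfGraph g z c d L₁ h₁ hP₁
    obtain ⟨T₂, hT₂⟩ := exists_shatters_of_halfGraph g z c d L₂ h₂ hP₂
    let T : Bool → LTree d := fun b => if b = c then T₁ else T₂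
    refine ⟨(z i, T false, T true), shatters_succ fun b => ?_⟩
    by_cases hb : b = c
    · simp only [T, hb, if_true]
      refine hT₁.mono ?_
      rintro _ ⟨j, hj, rfl⟩
      exact ⟨⟨j, by simp [hj], rfl⟩, (hP₁₂ j hj i (by simp)).1⟩
    · simp only [T, hb, if_false]
      refine hT₂.mono ?_
      rintro _ ⟨j, hj, rfl⟩
      refine ⟨⟨j, by simp [hj], rfl⟩, ?_⟩
      rw [(hi j hj).2]
      cases b <;> cases c <;> simp_all

/-! ### Stability and definability of limits -/

/-- Ramsey's theorem for pairs of natural numbers and two colors, in asymmetric finite form inside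
an infinite set `I`: for all lengths `a false` and `a true` there is, for some color `b`, an
increasing list of `a b` elements of `I` whose pairs all have color `b`. -/
theorem exists_monochromatic_list (e : ℕ → ℕ → Bool) (a : Bool → ℕ) (I : Set ℕ)
    (hI : I.Infinite) : ∃ (b : Bool) (L : List ℕ), L.length = a b ∧ (∀ i ∈ L, i ∈ I) ∧
      L.Pairwise fun i j => i < j ∧ e i j = b := by
  induction hn : a false + a true using Nat.strong_induction_on generalizing a I with
  | _ n ih =>
    by_cases h0 : ∃ b, a b = 0
    · obtain ⟨b, hb⟩ := h0
      exact ⟨b, [], by simp [hb], by simp, List.Pairwise.nil⟩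
    push Not at h0
    obtain ⟨i, hi⟩ := hI.nonempty
    -- infinitely many pairs `(i, j)` have the same color `c`
    obtain ⟨c, hc⟩ : ∃ c, (I ∩ {j | i < j ∧ e i j = c}).Infinite := by
      by_contra! h
      have hfin := ((h false).union (h true)).union (Set.finite_Iic i)
      refine hI (hfin.subset fun j hj => ?_)
      rcases le_or_gt j i with hji | hij
      · exact Or.inr hji
      · cases hb : e i j
        · exact Or.inl (Or.inl ⟨hj, hij, hb⟩)
        · exact Or.inl (Or.inr ⟨hj, hij, hb⟩)
    have hlt : Function.update a c (a c - 1) false + Function.update a c (a c - 1) true < n := by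
      have := h0 false
      have := h0 true
      cases c <;> simp <;> omega
    obtain ⟨b, L, hL, hLI, hP⟩ := ih _ hlt (Function.update a c (a c - 1)) _ hc rfl
    by_cases hbc : b = c
    · subst hbc
      refine ⟨b, i :: L, ?_, ?_, List.pairwise_cons.2 ⟨fun j hj => (hLI j hj).2, hP⟩⟩
      · have := h0 b
        simp at hL
        simp; omega
      · exact List.forall_mem_cons.2 ⟨hi, fun j hj => (hLI j hj).1⟩
    · exact ⟨b, L, by simpa [hbc] using hL, fun j hj => (hLI j hj).1, hP⟩

/-- Let `f` be a pointwise limit of functions from `G`. If `f` is not determined by the values of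
finitely many functions from `G`, then `G` shatters Littlestone trees of every depth. -/
theorem exists_shatters_of_not_determined {G : HypothesisClass} {f : ℕ → Bool}
    (hlim : ∀ F : Finset ℕ, ∃ g ∈ G, ∀ x ∈ F, g x = f x)
    (hdet : ∀ t : Finset (ℕ → Bool), (∀ g ∈ t, g ∈ G) →
      ∃ x y, (∀ g ∈ t, g x = g y) ∧ f x ≠ f y) (d : ℕ) :
    ∃ T : LTree d, Shatters G T := by
  classical
  -- Functions `g n` and points `x n`, `y n` such that `f` takes the values `1` at `x n` and `0` at
  -- `y n`, later functions agree with `f` there, and earlier functions do not tell them apart.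
  obtain ⟨u, hu, hlt⟩ := exists_seq_of_forall_finset_exists
    (fun a : (ℕ → Bool) × ℕ × ℕ => a.1 ∈ G ∧ f a.2.1 = true ∧ f a.2.2 = false)
    (fun a b => a.1 b.2.1 = a.1 b.2.2 ∧ b.1 a.2.1 = true ∧ b.1 a.2.2 = false) fun s hs => by
      obtain ⟨g, hg, hgf⟩ := hlim (s.image (fun a => a.2.1) ∪ s.image fun a => a.2.2)
      obtain ⟨x, y, hxy, hf, hf'⟩ : ∃ x y, (∀ a ∈ s, a.1 x = a.1 y) ∧
          f x = true ∧ f y = false := by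
        obtain ⟨x, y, h, hne⟩ := hdet (s.image Prod.fst) fun g hg => by
          obtain ⟨a, ha, rfl⟩ := Finset.mem_image.1 hg
          exact (hs a ha).1
        have h' : ∀ a ∈ s, a.1 x = a.1 y := fun a ha => h _ (Finset.mem_image_of_mem _ ha)
        cases hx : f x
        · exact ⟨y, x, fun a ha => (h' a ha).symm, by simpa [hx] using hne.symm, hx⟩
        · exact ⟨x, y, h', hx, by simpa [hx] using hne.symm⟩
      refine ⟨(g, x, y), ⟨hg, hf, hf'⟩, fun a ha => ⟨hxy a ha, ?_, ?_⟩⟩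
      · rw [← (hs a ha).2.1]
        exact hgf _ (Finset.mem_union_left _ (Finset.mem_image_of_mem (fun a => a.2.1) ha))
      · rw [← (hs a ha).2.2]
        exact hgf _ (Finset.mem_union_right _ (Finset.mem_image_of_mem (fun a => a.2.2) ha))
  obtain ⟨c, L, hL, -, hP⟩ := exists_monochromatic_list (fun i j => (u i).1 (u j).2.1)
    (fun _ => 2 ^ (d + 1) - 1) Set.univ Set.infinite_univ
  -- Earlier functions take the value `c` at both points, so the point where `f` has the value `!c`
  -- separates them from the later ones.
  obtain ⟨T, hT⟩ := exists_shatters_of_halfGraph (fun i => (u i).1)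
    (fun i => if c then (u i).2.2 else (u i).2.1) c d L hL <| hP.imp fun {i j} h => by
      obtain ⟨h1, h2, h3⟩ := hlt i j h.1
      have h4 := h.2
      cases c <;> simp_all
  exact ⟨T, hT.mono (by rintro _ ⟨i, -, rfl⟩; exact (hu i).1)⟩

/-! ### Computability of the members -/

/-- Every member of an effectively closed class of finite Littlestone dimension is computable. -/
theorem EffectivelyClosed.computable_of_not_shatters {C : HypothesisClass}
    (hC : EffectivelyClosed C) {d : ℕ} (hd : ∀ T : LTree d, ¬ Shatters C T) {f : ℕ → Bool}
    (hf : f ∈ C) : Computable f := by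
  induction d generalizing C f with
  | zero => exact absurd (shatters_zero ⟨f, hf⟩ ()) (hd ())
  | succ d ih =>
    by_contra hnc
    have hother : ∀ g ∈ C, g ≠ f → Computable g := by
      intro g hg hne
      obtain ⟨x, hx⟩ := Function.ne_iff.1 hne
      -- the half of smaller dimension contains `f` or `g`, hence `g`
      obtain ⟨b, hb⟩ := exists_restrict_not_shatters hd x
      have hgb : g x = b := by
        by_contra hgb
        have hfb : f x = b := by
          revert hx hgb; cases f x <;> cases g x <;> cases b <;> simp
        exact hnc (ih (hC.restrict x b) hb ⟨hf, hfb⟩)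
      exact ih (hC.restrict x b) hb ⟨hg, hgb⟩
    obtain ⟨T, hT⟩ := exists_shatters_of_not_determined (G := {g ∈ C | g ≠ f}) (f := f) (d := d + 1)
      (fun F => by
        by_contra! h
        refine hnc ((hC.restrict_finset f F).computable_of_unique ⟨hf, fun _ _ => rfl⟩ ?_)
        rintro g ⟨hg, hgF⟩
        by_contra hne
        obtain ⟨x, hx, hx'⟩ := h g ⟨hg, hne⟩
        exact hx' (hgF x hx))
      (fun t ht => by
        by_contra! h
        exact hnc (computable_of_determined t id
          (fun g hg => hother g (ht g hg).1 (ht g hg).2) h))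
    exact hd T (hT.mono fun g hg => hg.1)

end EffLittlestone

theorem mainTheorem2 (H : EffLittlestone.HypothesisClass) (hH : EffLittlestone.eldim H < ⊤) :
    ∀ f ∈ H, Computable f := by
  obtain ⟨_, ⟨d, -, A, hA, hAH⟩, -⟩ := sInf_lt_iff.1 hH
  intro f hf
  have hF : Computable fun T : EffLittlestone.LTree (d + 1) => T.sampleAt (A T) :=
    (EffLittlestone.primrec₂_sampleAt (d + 1)).to_comp.comp Computable.id hA
  refine (EffLittlestone.effectivelyClosed_of_computable hF).computable_of_not_shatters (d := d + 1) ?_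
    fun T hc => hAH T ⟨f, hf, hc⟩
  intro T hT
  obtain ⟨g, hg, hc⟩ := hT (A T)
  exact hg T hc
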